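/- A \emph{temporal structure} is a relational structure $\mathfrak B$ (over an arbitrary relational signature) with domain $\mathbb Q$ all of whose relations are first-order definable, without parameters, in $(\mathbb Q;<)$. A relation $R\subseteq\mathbb Q^n$ has a \emph{pp-definition} in $\mathfrak B$ if it is defined in $\mathfrak B$ by a primitive positive formula, i.e. a formula $\exists x_1,\dots,x_m(\phi_1\wedge\dots\wedge\phi_k)$ in which each $\phi_i$ is $\bot$, an equality between variables, or an application of a relation symbol of $\mathfrak B$ to variables. An operation $f\colon\mathbb Q^2\to\mathbb Q$ \emph{preserves} a relation $R\subseteq\mathbb Q^n$ if $s,t\in R$ implies $(f(s_1,t_1),\dots,f(s_n,t_n))\in R$, and $\mathfrak B$ is \emph{preserved by} $f$ if $f$ preserves every relation of $\mathfrak B$. Let \[ \mathrm R_{\min}=\{(x,y,z)\in\mathbb Q^3\mid y<x\vee z<x\},\qquad -\mathrm R_{\min}=\{(-x,-y,-z)\mid (x,y,z)\in\mathrm R_{\min}\}. \] \textbf{Theorem.} Let $\mathfrak B$ be a temporal structure that admits a pp-definition of $<$. Then exactly one of the following two statements is true: \begin{enumerate} \item $\mathfrak B$ admits a pp-definition of $\mathrm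 R_{\min}$ or of $-\mathrm R_{\min}$; \item $\mathfrak B$ is preserved by every injective binary operation $f\colon\mathbb Q^2\to\mathbb Q$ that preserves $\leq$. \end{enumerate} -/

import Mathlib

universe u v

namespace TemporalCSP

section General

universe w u'

variable {L : FirstOrder.Language.{u, v}} {α : Type u'}

/-- Nonempty finite conjunctions of atomic formulas, where `⊥`, equalities and
applications of relation symbols count as atomic. -/
inductive IsAtomicConj : ∀ {m : ℕ}, L.BoundedFormula α m → Prop
  | falsum {m : ℕ} : IsAtomicConj (⊥ : L.BoundedFormula α m)
  | atomic {m : ℕ} {φ : L.BoundedFormula α m} (h : φ.IsAtomic) : IsAtomicConj φ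
  | inf {m : ℕ} {φ ψ : L.BoundedFormula α m} (hφ : IsAtomicConj φ) (hψ : IsAtomicConj ψ) :
      IsAtomicConj (φ ⊓ ψ)

/-- Primitive positive formulas: existential quantifiers in front of a conjunction of
atomic formulas. -/
inductive IsPrimitivePositive : ∀ {m : ℕ}, L.BoundedFormula α m → Prop
  | conj {m : ℕ} {φ : L.BoundedFormula α m} (h : IsAtomicConj φ) : IsPrimitivePositive φ
  | ex {m : ℕ} {φ : L.BoundedFormula α (m + 1)} (h : IsPrimitivePositive φ) :
      IsPrimitivePositive φ.ex

variable {M : Type w}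

/-- The relation `R` has a primitive positive definition (without parameters) in the
`L`-structure `M`. -/
def PPDefinable (L : FirstOrder.Language.{u, v}) [L.Structure M] {n : ℕ} (R : Set (Fin n → M)) : Prop :=
  ∃ φ : L.Formula (Fin n), IsPrimitivePositive φ ∧ R = {t | φ.Realize t}

/-- The `k`-ary operation `f`, applied componentwise to tuples, preserves the relation `R`. -/
def Preserves {k n : ℕ} (f : (Fin k → M) → M) (R : Set (Fin n → M)) : Prop :=
  ∀ t : Fin k → Fin n → M, (∀ i, t i ∈ R) → (fun j => f (fun i => t i j)) ∈ R

/-- The operation `f` is a polymorphism of (preserves) the `L`-structure `M`: it preserves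
the interpretation of every relation symbol. -/
def IsPolymorphism (L : FirstOrder.Language.{u, v}) [L.Structure M] {k : ℕ} (f : (Fin k → M) → M) : Prop :=
  ∀ (n : ℕ) (R : L.Relations n), Preserves f {t : Fin n → M | FirstOrder.Language.Structure.RelMap R t}

end General

/-- The relation symbols of the signature `{<}`: one binary symbol. -/
inductive LtSymb : ℕ → Type
  | lt : LtSymb 2

/-- The signature `{<}`. -/
def ltLanguage : FirstOrder.Language.{0, 0} := ⟨fun _ => Empty, LtSymb⟩

/-- The structure `(ℚ; <)`. -/
instance ratLtStructure : ltLanguage.Structure ℚ where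
  funMap := fun {_} f _ => Empty.elim f
  RelMap := fun {_} R =>
    match R with
    | LtSymb.lt => fun t => t 0 < t 1

/-- An `L`-structure on `ℚ` is temporal if all its relations are first-order definable
(without parameters) in `(ℚ; <)`. -/
def IsTemporal (L : FirstOrder.Language.{u, v}) [L.Structure ℚ] : Prop :=
  ∀ (n : ℕ) (R : L.Relations n),
    (∅ : Set ℚ).Definable ltLanguage {t : Fin n → ℚ | FirstOrder.Language.Structure.RelMap R t}

/-- The relation `<` on `ℚ`. -/
def ltRel : Set (Fin 2 → ℚ) := {t | t 0 < t 1}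

/-- The relation `≤` on `ℚ`. -/
def leRel : Set (Fin 2 → ℚ) := {t | t 0 ≤ t 1}

/-- `R_min = {(x, y, z) | y < x ∨ z < x}`. -/
def rMin : Set (Fin 3 → ℚ) := {t | t 1 < t 0 ∨ t 2 < t 0}

/-- The dual `-R = {-t | t ∈ R}` of a relation on `ℚ`. -/
def dualRel {n : ℕ} (R : Set (Fin n → ℚ)) : Set (Fin n → ℚ) :=
  {s | ∃ t ∈ R, s = fun i => -t i}

end TemporalCSP

namespace TemporalCSP

open FirstOrder FirstOrder.Language

/-! ### Calculus of pp-definable relations, with free and auxiliary coordinates in arbitrary types.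
-/

section PrimitivePositiveCalculus

universe w

variable {L : FirstOrder.Language.{u, v}} {M : Type w}

/-! Suppose neither `rMin` nor its dual is pp-definable, and let `f` be injective and monotone.
Given `s`, `t` in a relation `R`, put `w = f(s, t)`. Each sublevel set of `w` is closed downwards in
the product order of `s` and `t`, hence is a finite union of intersections of a cut of `s` with a
cut of `t`. Non-definability of `rMin` closes the cuts attained in `R` under intersection, and that
of its dual under union, so each sublevel set of `w` is a cut of some tuple of `R`. A Helly-type
argument, again from non-definability of `rMin`, gives one tuple attaining all these nested cuts.
Once the equalities of `w` are imposed as well, that tuple has the order type of `w`, so `w` lies in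
`R` by homogeneity of `(ℚ; <)`.

Conversely, an injective monotone operation with `f(1,1)` below `f(0,2)` and `f(2,0)` violates
`rMin`, and its conjugate under negation violates the dual. -/

theorem IsAtomicConj.relabel {α β : Type*} {m k : ℕ} {φ : L.BoundedFormula α m}
    (h : IsAtomicConj φ) (g : α → β ⊕ Fin k) : IsAtomicConj (φ.relabel g) := by
  induction h with
  | falsum => exact IsAtomicConj.falsum
  | atomic h => exact IsAtomicConj.atomic (h.relabel g)
  | inf _ _ ih₁ ih₂ => exact IsAtomicConj.inf ih₁ ih₂

theorem IsAtomicConj.toFormula {α : Type*} {m : ℕ} {φ : L.BoundedFormula α m}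
    (h : IsAtomicConj φ) : IsAtomicConj φ.toFormula := by
  induction h with
  | falsum => exact IsAtomicConj.falsum
  | atomic h =>
    cases h with
    | equal t₁ t₂ => exact IsAtomicConj.atomic (BoundedFormula.IsAtomic.equal _ _)
    | rel R ts => exact IsAtomicConj.atomic (BoundedFormula.IsAtomic.rel _ _)
  | inf _ _ ih₁ ih₂ => exact IsAtomicConj.inf ih₁ ih₂

theorem IsPrimitivePositive.exs {α : Type*} : ∀ {m : ℕ} {φ : L.BoundedFormula α m},
    IsPrimitivePositive φ → IsPrimitivePositive φ.exs
  | 0, _, h => h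
  | _ + 1, _, h => (IsPrimitivePositive.exs (IsPrimitivePositive.ex h) :)

variable [L.Structure M] {α β : Type}

/-- Primitive positive definability of a relation whose coordinates are indexed by an arbitrary
type: the relation is a projection of one defined by a conjunction of atomic formulas. -/
def PPSet (L : FirstOrder.Language.{u, v}) [L.Structure M] {α : Type} (R : Set (α → M)) : Prop :=
  ∃ (γ : Type) (_ : Finite γ) (θ : L.Formula (α ⊕ γ)), IsAtomicConj θ ∧
    ∀ t, t ∈ R ↔ ∃ y : γ → M, θ.Realize (Sum.elim t y)

theorem PPSet.of_isAtomicConj {θ : L.Formula α} (h : IsAtomicConj θ) :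
    PPSet L {t : α → M | θ.Realize t} := by
  refine ⟨Empty, inferInstance, θ.relabel Sum.inl, h.relabel _, fun t => ?_⟩
  simp

theorem PPSet.reindex {R : Set (α → M)} (hR : PPSet L R) (g : α → β) :
    PPSet L {t : β → M | t ∘ g ∈ R} := by
  obtain ⟨γ, hγ, θ, hθ, h⟩ := hR
  refine ⟨γ, hγ, θ.relabel (Sum.map g id), hθ.relabel _, fun t => ?_⟩
  simp only [Set.mem_ofPred_eq, h, Formula.realize_relabel, Sum.elim_comp_map, Function.comp_id]

theorem PPSet.exists {R : Set (α ⊕ β → M)} [Finite β] (hR : PPSet L R) :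
    PPSet L {t : α → M | ∃ y : β → M, Sum.elim t y ∈ R} := by
  obtain ⟨γ, hγ, θ, hθ, h⟩ := hR
  refine ⟨β ⊕ γ, inferInstance, θ.relabel (Equiv.sumAssoc α β γ), hθ.relabel _, fun t => ?_⟩
  have key : ∀ (y : β → M) (z : γ → M),
      Sum.elim t (Sum.elim y z) ∘ Equiv.sumAssoc α β γ = Sum.elim (Sum.elim t y) z := by
    intro y z; ext ((_ | _) | _) <;> rfl
  simp only [Set.mem_ofPred_eq, h, Formula.realize_relabel]
  constructor
  · rintro ⟨y, z, hz⟩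
    exact ⟨Sum.elim y z, by rwa [key]⟩
  · rintro ⟨y, hy⟩
    refine ⟨y ∘ Sum.inl, y ∘ Sum.inr, ?_⟩
    rwa [← key, Sum.elim_comp_inl_inr]

theorem PPSet.inter {R S : Set (α → M)} (hR : PPSet L R) (hS : PPSet L S) :
    PPSet L {t | t ∈ R ∧ t ∈ S} := by
  obtain ⟨γ, hγ, θ, hθ, h⟩ := hR
  obtain ⟨δ, hδ, η, hη, h'⟩ := hS
  refine ⟨γ ⊕ δ, inferInstance,
    θ.relabel (Sum.map id Sum.inl) ⊓ η.relabel (Sum.map id Sum.inr),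
    (hθ.relabel _).inf (hη.relabel _), fun t => ?_⟩
  simp only [Set.mem_ofPred_eq, h, h', Formula.realize_inf, Formula.realize_relabel,
    Sum.elim_comp_map, Function.comp_id]
  constructor
  · rintro ⟨⟨y, hy⟩, ⟨z, hz⟩⟩
    exact ⟨Sum.elim y z, by simpa using hy, by simpa using hz⟩
  · rintro ⟨y, hy, hz⟩
    exact ⟨⟨_, hy⟩, ⟨_, hz⟩⟩

theorem PPSet.eq (i j : α) : PPSet L {t : α → M | t i = t j} := by
  have := PPSet.of_isAtomicConj (M := M) (θ := ((Term.var i : L.Term α).equal (Term.var j)))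
    (IsAtomicConj.atomic (BoundedFormula.IsAtomic.equal _ _))
  simpa using this

theorem PPSet.true [Nonempty M] : PPSet L {_t : α → M | True} := by
  -- Conjunctions are nonempty and `α` may be empty, so truth is written `∃ y, y = y`.
  refine ⟨Unit, inferInstance, (Term.var (Sum.inr ()) : L.Term (α ⊕ Unit)).equal
    (Term.var (Sum.inr ())), IsAtomicConj.atomic (BoundedFormula.IsAtomic.equal _ _), ?_⟩
  simp

theorem PPSet.imp [Nonempty M] {R : Set (α → M)} (p : Prop) (hR : p → PPSet L R) :
    PPSet L {t | p → t ∈ R} := by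
  by_cases hp : p
  · simpa [hp] using hR hp
  · simpa [hp] using PPSet.true (L := L) (M := M) (α := α)

theorem PPSet.forall [Nonempty M] {ι : Type*} [Finite ι] {R : ι → Set (α → M)}
    (hR : ∀ i, PPSet L (R i)) : PPSet L {t | ∀ i, t ∈ R i} := by
  have key : ∀ s : Set ι, s.Finite → PPSet L {t | ∀ i ∈ s, t ∈ R i} := by
    intro s hs
    induction s, hs using Set.Finite.induction_on with
    | empty => simpa using PPSet.true (L := L) (M := M) (α := α)
    | insert _ _ ih => simpa using (hR _).inter ih
  simpa using key Set.univ Set.finite_univ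

theorem PPSet.relMap {n : ℕ} (R : L.Relations n) :
    PPSet L {t : Fin n → M | Structure.RelMap R t} := by
  have := PPSet.of_isAtomicConj (M := M) (θ := R.formula fun i => (Term.var i : L.Term (Fin n)))
    (IsAtomicConj.atomic (BoundedFormula.IsAtomic.rel _ _))
  simpa [Formula.realize_rel] using this

theorem PPSet.of_isPrimitivePositive {m : ℕ} {φ : L.BoundedFormula α m}
    (h : IsPrimitivePositive φ) :
    PPSet L {t : α ⊕ Fin m → M | φ.Realize (t ∘ Sum.inl) (t ∘ Sum.inr)} := by
  induction h with
  | conj h => simpa using PPSet.of_isAtomicConj (M := M) h.toFormula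
  | @ex m φ _ ih =>
    have := (ih.reindex (Sum.elim (Sum.inl ∘ Sum.inl)
      (Fin.snoc (α := fun _ => (α ⊕ Fin m) ⊕ Unit) (Sum.inl ∘ Sum.inr) (Sum.inr ())))).exists
    convert this using 1
    ext t
    simp only [Set.mem_ofPred_eq, BoundedFormula.realize_ex]
    have key : ∀ y : Unit → M, (Sum.elim t y ∘ Sum.elim (Sum.inl ∘ Sum.inl)
        (Fin.snoc (α := fun _ => (α ⊕ Fin m) ⊕ Unit) (Sum.inl ∘ Sum.inr) (Sum.inr ()))) ∘ Sum.inr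
        = Fin.snoc (α := fun _ => M) (t ∘ Sum.inr) (y ()) := by
      intro y
      ext i
      refine Fin.lastCases ?_ (fun i => ?_) i <;> simp
    simp only [key]
    exact ⟨fun ⟨a, ha⟩ => ⟨fun _ => a, ha⟩, fun ⟨y, hy⟩ => ⟨y (), hy⟩⟩

theorem PPDefinable.ppSet {n : ℕ} {R : Set (Fin n → M)} (h : PPDefinable L R) : PPSet L R := by
  obtain ⟨φ, hφ, rfl⟩ := h
  have := (PPSet.of_isPrimitivePositive (M := M) hφ).reindex (Sum.elim id Fin.elim0)
  convert this using 1
  ext t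
  simp only [Set.mem_ofPred_eq, Formula.Realize]
  exact iff_of_eq (congrArg _ (Subsingleton.elim _ _))

theorem PPSet.ppDefinable {n : ℕ} {R : Set (Fin n → M)} (h : PPSet L R) : PPDefinable L R := by
  obtain ⟨γ, hγ, θ, hθ, h⟩ := h
  refine ⟨θ.iExs γ, IsPrimitivePositive.exs (.conj (hθ.relabel _)), ?_⟩
  ext t
  simp [h]

/-- Terms are variables, so they commute with `f`. The index `i₀` excludes arity 0, where `hk` is
vacuous and `⊥` would not be preserved. -/
theorem IsAtomicConj.preserves [L.IsRelational] {k : ℕ} {f : (Fin k → M) → M}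
    (hf : IsPolymorphism L f) {m : ℕ} {φ : L.BoundedFormula α m} (h : IsAtomicConj φ)
    (t : Fin k → α → M) (y : Fin k → Fin m → M) (hk : ∀ i, φ.Realize (t i) (y i)) (i₀ : Fin k) :
    φ.Realize (fun a => f fun i => t i a) (fun j => f fun i => y i j) := by
  have key : ∀ {m : ℕ} (y : Fin k → Fin m → M) (s : L.Term (α ⊕ Fin m)),
      s.realize (Sum.elim (fun a => f fun i => t i a) (fun j => f fun i => y i j)) =
        f fun i => s.realize (Sum.elim (t i) (y i)) := by
    intro m y s
    cases s with
    | var a => cases a <;> rfl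
    | func g => exact isEmptyElim g
  induction h with
  | falsum => exact hk i₀
  | atomic h =>
    cases h with
    | equal t₁ t₂ =>
      simp only [BoundedFormula.realize_bdEqual, key] at hk ⊢
      simp only [hk]
    | rel R ts =>
      simp only [BoundedFormula.realize_rel, key] at hk ⊢
      exact hf _ R _ hk
  | inf _ _ ih₁ ih₂ =>
    simp only [BoundedFormula.realize_inf] at hk ⊢
    exact ⟨ih₁ fun i => (hk i).1, ih₂ fun i => (hk i).2⟩

theorem PPSet.preserves [L.IsRelational] {k : ℕ} {f : (Fin k → M) → M}
    (hf : IsPolymorphism L f) {R : Set (α → M)} (hR : PPSet L R) (t : Fin k → α → M)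
    (ht : ∀ i, t i ∈ R) (i₀ : Fin k) : (fun a => f fun i => t i a) ∈ R := by
  obtain ⟨γ, hγ, θ, hθ, h⟩ := hR
  simp only [h] at ht ⊢
  choose y hy using ht
  refine ⟨fun c => f fun i => y i c, ?_⟩
  have := hθ.preserves hf (fun i => Sum.elim (t i) (y i)) (fun _ => default) hy i₀
  rw [Formula.Realize]
  convert this using 1
  ext (_ | _) <;> rfl

end PrimitivePositiveCalculus

/-! ### Homogeneity of the rational order -/

section Homogeneity

/-- Homogeneity of `(ℚ; <)`: two finite tuples with the same order type are related by an
automorphism. -/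
theorem exists_orderIso_comp_eq {ι : Type*} [Finite ι] (v w : ι → ℚ)
    (h : ∀ i j, v i < v j ↔ w i < w j) : ∃ σ : ℚ ≃o ℚ, ∀ i, σ (v i) = w i := by
  classical
  cases nonempty_fintype ι
  -- Back-and-forth started from the finite partial isomorphism `v i ↦ w i`.
  let p : Order.PartialIso ℚ ℚ := ⟨Finset.univ.image fun i => (v i, w i), by
    simp only [Finset.mem_image, Finset.mem_univ, true_and]
    rintro _ ⟨i, rfl⟩ _ ⟨j, rfl⟩
    have h₁ := h i j
    have h₂ := h j i
    rcases lt_trichotomy (v i) (v j) with hij | hij | hij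
    · rw [cmp_eq_lt_iff _ _ |>.2 hij, cmp_eq_lt_iff _ _ |>.2 (h₁.1 hij)]
    · have : w i = w j := by
        rw [hij] at h₁ h₂
        exact le_antisymm (not_lt.1 fun h' => lt_irrefl _ (h₂.2 h'))
          (not_lt.1 fun h' => lt_irrefl _ (h₁.2 h'))
      simp [hij, this]
    · rw [cmp_eq_gt_iff _ _ |>.2 hij, cmp_eq_gt_iff _ _ |>.2 (h₂.1 hij)]⟩
  let toCofinal : ℚ ⊕ ℚ → Order.Cofinal (Order.PartialIso ℚ ℚ) := fun p =>
    Sum.recOn p (Order.PartialIso.definedAtLeft ℚ) (Order.PartialIso.definedAtRight ℚ)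
  let I : Order.Ideal (Order.PartialIso ℚ ℚ) := Order.idealOfCofinals p toCofinal
  let F a := Order.PartialIso.funOfIdeal a I
    (Order.cofinal_meets_idealOfCofinals _ toCofinal (Sum.inl a))
  let G b := Order.PartialIso.invOfIdeal b I
    (Order.cofinal_meets_idealOfCofinals _ toCofinal (Sum.inr b))
  refine ⟨OrderIso.ofCmpEqCmp (fun a => (F a).val) (fun b => (G b).val) fun a b => ?_, fun i => ?_⟩
  · rcases (F a).prop with ⟨f, hf, ha⟩
    rcases (G b).prop with ⟨g, hg, hb⟩
    rcases I.directed _ hf _ hg with ⟨m, _, fm, gm⟩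
    exact m.prop (a, _) (fm ha) (_, b) (gm hb)
  · rcases (F (v i)).prop with ⟨f, hf, ha⟩
    rcases I.directed _ hf _ (Order.mem_idealOfCofinals p toCofinal) with ⟨m, _, fm, pm⟩
    have := m.prop _ (fm ha) (v i, w i)
      (pm (Finset.mem_image.2 ⟨i, Finset.mem_univ i, rfl⟩))
    exact (by simpa using this.symm : (F (v i)).val = w i)

variable {L : FirstOrder.Language.{u, v}} [L.Structure ℚ]

/-- An order automorphism of `ℚ` as an automorphism of the structure `(ℚ; <)`. -/
def ltEquiv (σ : ℚ ≃o ℚ) : ℚ ≃[ltLanguage] ℚ where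
  toEquiv := σ.toEquiv
  map_fun' := fun f => Empty.elim f
  map_rel' := fun R t => by
    cases R
    exact σ.lt_iff_lt

theorem IsTemporal.isPolymorphism_orderIso (hB : IsTemporal L) (σ : ℚ ≃o ℚ) :
    IsPolymorphism L fun x : Fin 1 → ℚ => σ (x 0) := by
  intro n R t ht
  obtain ⟨φ, hφ⟩ := Set.empty_definable_iff.1 (hB n R)
  rw [hφ] at ht ⊢
  exact (StrongHomClass.realize_formula (ltEquiv σ) φ).2 (ht 0)

/-- Order automorphisms are polymorphisms, so membership depends only on the order type of a tuple.
-/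
theorem IsTemporal.mem_of_ppSet [L.IsRelational] (hB : IsTemporal L) {α : Type} [Finite α]
    {R : Set (α → ℚ)} (hR : PPSet L R) {v w : α → ℚ} (h : ∀ i j, v i < v j ↔ w i < w j)
    (hv : v ∈ R) : w ∈ R := by
  obtain ⟨σ, hσ⟩ := exists_orderIso_comp_eq v w h
  have := hR.preserves (hB.isPolymorphism_orderIso σ) (fun _ => v) (fun _ => hv) 0
  simpa only [hσ] using this

theorem PPSet.lt (hlt : PPDefinable L ltRel) {α : Type} (i j : α) :
    PPSet L {t : α → ℚ | t i < t j} :=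
  hlt.ppSet.reindex ![i, j]

end Homogeneity

/-! ### What non-definability of `rMin` and its dual provides -/

section Exclusion

variable {L : FirstOrder.Language.{u, v}} [L.Structure ℚ] [L.IsRelational]

/-- The upward shape of `R_min`: a tuple realizing one disjunct can be moved to any triple
satisfying this disjunct. -/
theorem IsTemporal.exists_moved (hB : IsTemporal L) {α : Type} [Finite α] {P : Set (α → ℚ)}
    (hP : PPSet L P) {s : α → ℚ} (hs : s ∈ P) {i j k : α} (hji : s j < s i) (hik : s i < s k)
    {x y z : ℚ} (hyx : y < x) : ∃ u ∈ P, u i < x ∧ y < u j ∧ z < u k := by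
  obtain ⟨b, hyb, hbx⟩ := exists_between hyx
  obtain ⟨a, hya, hab⟩ := exists_between hyb
  obtain ⟨c, hc⟩ := exists_gt (max b z)
  rw [max_lt_iff] at hc
  obtain ⟨σ, hσ⟩ := exists_orderIso_comp_eq ![s j, s i, s k] ![a, b, c] (by
    intro p q
    fin_cases p <;> fin_cases q <;> simp <;> constructor <;> intros <;> linarith)
  have h₀ : σ (s j) = a := hσ 0
  have h₁ : σ (s i) = b := hσ 1
  have h₂ : σ (s k) = c := hσ 2
  refine ⟨fun a => σ (s a), hB.mem_of_ppSet hP (fun _ _ => σ.lt_iff_lt.symm) hs, ?_, ?_, ?_⟩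
  · exact h₁.trans_lt hbx
  · exact hya.trans_eq h₀.symm
  · exact hc.2.trans_eq h₂.symm

/-- Otherwise every `u ∈ P` has `u j < u i` or `u k < u i`, and then `∃ u ∈ P, u i < x ∧ y < u j ∧ z
< u k` defines `rMin`: moved copies of `s` and `t` realize the two disjuncts. -/
theorem IsTemporal.exists_le_of_not_rMin (hB : IsTemporal L) (hlt : PPDefinable L ltRel)
    (hmin : ¬ PPDefinable L rMin) {α : Type} [Finite α] {P : Set (α → ℚ)} (hP : PPSet L P)
    {s t : α → ℚ} (hs : s ∈ P) (ht : t ∈ P) {i j k : α} (hsj : s j < s i) (hsk : s i < s k)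
    (htk : t k < t i) (htj : t i < t j) : ∃ u ∈ P, u i ≤ u j ∧ u i ≤ u k := by
  by_contra! hu
  apply hmin
  have hS := ((hP.reindex (Sum.inr : α → Fin 3 ⊕ α)).inter
    ((PPSet.lt hlt (Sum.inr i) (Sum.inl (0 : Fin 3))).inter
      ((PPSet.lt hlt (Sum.inl 1) (Sum.inr j)).inter
        (PPSet.lt hlt (Sum.inl 2) (Sum.inr k))))).exists
  convert hS.ppDefinable using 1
  ext x
  simp only [rMin, Set.mem_ofPred_eq, Sum.elim_inl, Sum.elim_inr, Sum.elim_comp_inr]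
  constructor
  · rintro (h | h)
    · exact hB.exists_moved hP hs hsj hsk h
    · obtain ⟨u, h₁, h₂, h₃, h₄⟩ := hB.exists_moved hP ht htk htj (z := x 1) h
      exact ⟨u, h₁, h₂, h₄, h₃⟩
  · rintro ⟨u, h₁, h₂, h₃, h₄⟩
    by_contra! hx
    exact absurd (hu u h₁ (by linarith [hx.1])) (by linarith [hx.2])

theorem dualRel_rMin : dualRel rMin = {t | t 0 < t 1 ∨ t 0 < t 2} := by
  ext x
  constructor
  · rintro ⟨t, ht, rfl⟩
    simpa [rMin] using ht
  · intro hx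
    exact ⟨-x, by simpa [rMin] using hx, by ext; simp⟩

theorem IsTemporal.exists_moved_dual (hB : IsTemporal L) {α : Type} [Finite α] {P : Set (α → ℚ)}
    (hP : PPSet L P) {s : α → ℚ} (hs : s ∈ P) {i j k : α} (hij : s i < s j) (hki : s k < s i)
    {x y z : ℚ} (hxy : x < y) : ∃ u ∈ P, x < u i ∧ u j < y ∧ u k < z := by
  obtain ⟨b, hxb, hby⟩ := exists_between hxy
  obtain ⟨a, hba, hay⟩ := exists_between hby
  obtain ⟨c, hc⟩ := exists_lt (min b z)
  rw [lt_min_iff] at hc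
  obtain ⟨σ, hσ⟩ := exists_orderIso_comp_eq ![s j, s i, s k] ![a, b, c] (by
    intro p q
    fin_cases p <;> fin_cases q <;> simp <;> constructor <;> intros <;> linarith)
  have h₀ : σ (s j) = a := hσ 0
  have h₁ : σ (s i) = b := hσ 1
  have h₂ : σ (s k) = c := hσ 2
  refine ⟨fun a => σ (s a), hB.mem_of_ppSet hP (fun _ _ => σ.lt_iff_lt.symm) hs, ?_, ?_, ?_⟩
  · exact hxb.trans_eq h₁.symm
  · exact h₀.trans_lt hay
  · exact h₂.trans_lt hc.2

theorem IsTemporal.exists_ge_of_not_dualRel_rMin (hB : IsTemporal L) (hlt : PPDefinable L ltRel)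
    (hmax : ¬ PPDefinable L (dualRel rMin)) {α : Type} [Finite α] {P : Set (α → ℚ)}
    (hP : PPSet L P) {s t : α → ℚ} (hs : s ∈ P) (ht : t ∈ P) {i j k : α} (hsj : s i < s j)
    (hsk : s k < s i) (htk : t i < t k) (htj : t j < t i) : ∃ u ∈ P, u j ≤ u i ∧ u k ≤ u i := by
  by_contra! hu
  apply hmax
  have hS := ((hP.reindex (Sum.inr : α → Fin 3 ⊕ α)).inter
    ((PPSet.lt hlt (Sum.inl (0 : Fin 3)) (Sum.inr i)).inter
      ((PPSet.lt hlt (Sum.inr j) (Sum.inl 1)).inter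
        (PPSet.lt hlt (Sum.inr k) (Sum.inl 2))))).exists
  convert hS.ppDefinable using 1
  ext x
  simp only [dualRel_rMin, Set.mem_ofPred_eq, Sum.elim_inl, Sum.elim_inr, Sum.elim_comp_inr]
  constructor
  · rintro (h | h)
    · exact hB.exists_moved_dual hP hs hsj hsk h
    · obtain ⟨u, h₁, h₂, h₃, h₄⟩ := hB.exists_moved_dual hP ht htk htj (z := x 1) h
      exact ⟨u, h₁, h₂, h₄, h₃⟩
  · rintro ⟨u, h₁, h₂, h₃, h₄⟩
    by_contra! hx
    exact absurd (hu u h₁ (by linarith [hx.1])) (by linarith [hx.2])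

end Exclusion

/-! ### Cuts attained in a relation -/

section Cuts

variable {α : Type}

/-- The tuple `u` places all coordinates in `I` strictly below all other coordinates. -/
def IsCut (I : Set α) (u : α → ℚ) : Prop :=
  ∀ i ∈ I, ∀ j ∉ I, u i < u j

/-- The gap is strict because the thresholds later serve as coordinates that must be strictly
ordered. -/
theorem IsCut.exists_threshold [Finite α] {I : Set α} {u : α → ℚ} (h : IsCut I u) :
    ∃ q q', q < q' ∧ (∀ i ∈ I, u i < q) ∧ ∀ j ∉ I, q' < u j := by
  classical
  cases nonempty_fintype α
  obtain ⟨q, h₁, h₂⟩ := Order.exists_between_finsets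
    (Finset.univ.filter (· ∈ I) |>.image u) (Finset.univ.filter (· ∉ I) |>.image u) (by
      simpa [IsCut] using h)
  obtain ⟨q', h₁', h₂'⟩ := Order.exists_between_finsets
    {q} (Finset.univ.filter (· ∉ I) |>.image u) (by simpa using h₂)
  exact ⟨q, q', by simpa using h₁', by simpa using h₁, by simpa using h₂'⟩

theorem exists_forall_lt [Finite α] (u : α → ℚ) (q : ℚ) : ∃ m < q, ∀ i, m < u i := by
  cases nonempty_fintype α
  obtain ⟨m, -, hm⟩ := Order.exists_between_finsets ∅ (insert q (Finset.univ.image u)) (by simp)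
  simp only [Finset.mem_insert, Finset.mem_image, Finset.mem_univ, true_and,
    forall_eq_or_imp, forall_exists_index, forall_apply_eq_imp_iff] at hm
  exact ⟨m, hm⟩

theorem exists_forall_gt [Finite α] (u : α → ℚ) (q : ℚ) : ∃ m > q, ∀ i, u i < m := by
  obtain ⟨m, h₁, h₂⟩ := exists_forall_lt (-u) (-q)
  exact ⟨-m, by simpa using neg_lt_neg h₁, fun i => by simpa using neg_lt_neg (h₂ i)⟩

variable {L : FirstOrder.Language.{u, v}} [L.Structure ℚ]

theorem PPSet.forall_mem_lt (hlt : PPDefinable L ltRel) {β : Type} [Finite α] (g : α → β)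
    (A : Set α) (b : β) : PPSet L {t : β → ℚ | ∀ i ∈ A, t (g i) < t b} :=
  PPSet.forall fun i => PPSet.imp (i ∈ A) fun _ => PPSet.lt hlt (g i) b

theorem PPSet.forall_mem_gt (hlt : PPDefinable L ltRel) {β : Type} [Finite α] (g : α → β)
    (A : Set α) (b : β) : PPSet L {t : β → ℚ | ∀ i ∈ A, t b < t (g i)} :=
  PPSet.forall fun i => PPSet.imp (i ∈ A) fun _ => PPSet.lt hlt b (g i)

theorem PPSet.isCut (hlt : PPDefinable L ltRel) [Finite α] (I : Set α) :
    PPSet L {t : α → ℚ | IsCut I t} :=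
  PPSet.forall fun i => PPSet.imp (i ∈ I) fun _ => PPSet.forall_mem_gt hlt id Iᶜ i

variable [L.IsRelational]

/-- Add a coordinate above `I ∩ J`, one below `Iᶜ` and one below `Jᶜ`. If the first is at most the
other two, `I ∩ J` is a cut; `s` and `t` each achieve one of the two comparisons. -/
theorem IsTemporal.exists_isCut_inter (hB : IsTemporal L) (hlt : PPDefinable L ltRel)
    (hmin : ¬ PPDefinable L rMin) [Finite α] {R : Set (α → ℚ)} (hR : PPSet L R)
    {I J : Set α} {s t : α → ℚ} (hs : s ∈ R) (ht : t ∈ R) (hI : IsCut I s) (hJ : IsCut J t) :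
    ∃ u ∈ R, IsCut (I ∩ J) u := by
  have hP := (hR.reindex (Sum.inl : α → α ⊕ Fin 3)).inter
    ((PPSet.forall_mem_lt hlt (Sum.inl : α → α ⊕ Fin 3) (I ∩ J) (Sum.inr 0)).inter
      ((PPSet.forall_mem_gt hlt (Sum.inl : α → α ⊕ Fin 3) Iᶜ (Sum.inr 1)).inter
        (PPSet.forall_mem_gt hlt (Sum.inl : α → α ⊕ Fin 3) Jᶜ (Sum.inr 2))))
  obtain ⟨p, p', hp, hp₁, hp₂⟩ := hI.exists_threshold
  obtain ⟨q, q', hq, hq₁, hq₂⟩ := hJ.exists_threshold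
  obtain ⟨m, hmp, hm⟩ := exists_forall_lt s p
  obtain ⟨n, hnq, hn⟩ := exists_forall_lt t q
  obtain ⟨u, ⟨huR, hu₀, hu₁, hu₂⟩, h₁, h₂⟩ := hB.exists_le_of_not_rMin hlt hmin hP
    (s := Sum.elim s ![p, p', m]) (t := Sum.elim t ![q, n, q'])
    ⟨hs, fun i hi => hp₁ i hi.1, hp₂, fun i _ => hm i⟩
    ⟨ht, fun i hi => hq₁ i hi.2, fun i _ => hn i, hq₂⟩
    (i := Sum.inr 0) (j := Sum.inr 2) (k := Sum.inr 1) hmp hp hnq hq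
  refine ⟨u ∘ Sum.inl, huR, fun i hi j hj => (hu₀ i hi).trans ?_⟩
  by_cases hjI : j ∈ I
  · exact h₁.trans_lt (hu₂ j fun hjJ => hj ⟨hjI, hjJ⟩)
  · exact h₂.trans_lt (hu₁ j hjI)

theorem IsTemporal.exists_isCut_union (hB : IsTemporal L) (hlt : PPDefinable L ltRel)
    (hmax : ¬ PPDefinable L (dualRel rMin)) [Finite α] {R : Set (α → ℚ)} (hR : PPSet L R)
    {I J : Set α} {s t : α → ℚ} (hs : s ∈ R) (ht : t ∈ R) (hI : IsCut I s) (hJ : IsCut J t) :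
    ∃ u ∈ R, IsCut (I ∪ J) u := by
  have hP := (hR.reindex (Sum.inl : α → α ⊕ Fin 3)).inter
    ((PPSet.forall_mem_gt hlt (Sum.inl : α → α ⊕ Fin 3) (I ∪ J)ᶜ (Sum.inr 0)).inter
      ((PPSet.forall_mem_lt hlt (Sum.inl : α → α ⊕ Fin 3) I (Sum.inr 1)).inter
        (PPSet.forall_mem_lt hlt (Sum.inl : α → α ⊕ Fin 3) J (Sum.inr 2))))
  obtain ⟨p, p', hp, hp₁, hp₂⟩ := hI.exists_threshold
  obtain ⟨q, q', hq, hq₁, hq₂⟩ := hJ.exists_threshold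
  obtain ⟨m, hmp, hm⟩ := exists_forall_gt s p'
  obtain ⟨n, hnq, hn⟩ := exists_forall_gt t q'
  obtain ⟨u, ⟨huR, hu₀, hu₁, hu₂⟩, h₁, h₂⟩ := hB.exists_ge_of_not_dualRel_rMin hlt hmax hP
    (s := Sum.elim s ![p', p, m]) (t := Sum.elim t ![q', n, q])
    ⟨hs, fun i hi => hp₂ i fun h => hi (Or.inl h), hp₁, fun i _ => hm i⟩
    ⟨ht, fun i hi => hq₂ i fun h => hi (Or.inr h), fun i _ => hn i, hq₁⟩
    (i := Sum.inr 0) (j := Sum.inr 2) (k := Sum.inr 1) hmp hp hnq hq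
  refine ⟨u ∘ Sum.inl, huR, fun i hi j hj => lt_trans ?_ (hu₀ j hj)⟩
  rcases hi with hi | hi
  · exact (hu₁ i hi).trans_le h₂
  · exact (hu₂ i hi).trans_le h₁

/-- A cut compatible with the product order is attained: every set of coordinates closed downwards
with respect to `s` and `t` is a cut of some tuple in the relation. -/
theorem IsTemporal.exists_isCut_of_lower (hB : IsTemporal L) (hlt : PPDefinable L ltRel)
    (hmin : ¬ PPDefinable L rMin) (hmax : ¬ PPDefinable L (dualRel rMin)) [Finite α]
    {R : Set (α → ℚ)} (hR : PPSet L R) {s t : α → ℚ} (hs : s ∈ R) (ht : t ∈ R) {I : Set α}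
    (hI : ∀ i j, s i ≤ s j → t i ≤ t j → j ∈ I → i ∈ I) : ∃ u ∈ R, IsCut I u := by
  -- A lower set is the union of the principal lower sets of its elements, each an intersection of a
  -- cut of `s` and a cut of `t`.
  have key : ∀ K : Set α, K.Finite →
      ∃ u ∈ R, IsCut {i | ∃ j ∈ K, s i ≤ s j ∧ t i ≤ t j} u := by
    intro K hK
    induction K, hK using Set.Finite.induction_on with
    | empty => exact ⟨s, hs, by simp [IsCut]⟩
    | @insert a K _ _ ih =>
      obtain ⟨u, hu, hcut⟩ := ih
      obtain ⟨u', hu', hcut'⟩ := hB.exists_isCut_inter hlt hmin hR hs ht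
        (I := {i | s i ≤ s a}) (J := {i | t i ≤ t a})
        (fun i hi j hj => lt_of_le_of_lt hi (not_le.1 hj))
        (fun i hi j hj => lt_of_le_of_lt hi (not_le.1 hj))
      obtain ⟨w, hw, hcut''⟩ := hB.exists_isCut_union hlt hmax hR hu' hu hcut' hcut
      refine ⟨w, hw, ?_⟩
      convert hcut'' using 1
      ext i
      simp
  obtain ⟨u, hu, hcut⟩ := key I I.toFinite
  refine ⟨u, hu, ?_⟩
  convert hcut using 1
  ext i
  exact ⟨fun hi => ⟨i, hi, le_rfl, le_rfl⟩, fun ⟨j, hj, h₁, h₂⟩ => hI i j h₁ h₂ hj⟩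

/-- Two nested cuts attained separately in a primitively positively definable relation are attained
simultaneously. -/
theorem IsTemporal.exists_isCut_and (hB : IsTemporal L) (hlt : PPDefinable L ltRel)
    (hmin : ¬ PPDefinable L rMin) [Finite α] {R : Set (α → ℚ)} (hR : PPSet L R)
    {I J : Set α} (hIJ : I ⊆ J) {s t : α → ℚ} (hs : s ∈ R) (ht : t ∈ R) (hI : IsCut I s)
    (hJ : IsCut J t) : ∃ u ∈ R, IsCut I u ∧ IsCut J u := by
  -- Here `x 0 ≤ x 1` certifies the cut `I`, and `x 2 ≤ x 3` the cut `J`.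
  let S : Set (Fin 4 → ℚ) := {x | ∃ u ∈ R, (∀ i ∈ I, u i < x 0) ∧ (∀ i ∉ I, x 1 < u i) ∧
    (∀ i ∈ J, u i < x 2) ∧ (∀ i ∉ J, x 3 < u i) ∧ x 1 < x 2}
  have hS : PPSet L S :=
    ((hR.reindex (Sum.inr : α → Fin 4 ⊕ α)).inter
      ((PPSet.forall_mem_lt hlt (Sum.inr : α → Fin 4 ⊕ α) I (Sum.inl 0)).inter
        ((PPSet.forall_mem_gt hlt (Sum.inr : α → Fin 4 ⊕ α) Iᶜ (Sum.inl 1)).inter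
          ((PPSet.forall_mem_lt hlt (Sum.inr : α → Fin 4 ⊕ α) J (Sum.inl 2)).inter
            ((PPSet.forall_mem_gt hlt (Sum.inr : α → Fin 4 ⊕ α) Jᶜ (Sum.inl 3)).inter
              (PPSet.lt hlt (Sum.inl 1) (Sum.inl 2))))))).exists
  have hS₁ : ∀ a b b' c : ℚ, a < c → c < b → b < b' → ![a, b, b', c] ∈ S := by
    intro a b b' c hac hcb hbb
    obtain ⟨p, p'', hp, hp₁, hp₂⟩ := hI.exists_threshold
    obtain ⟨p', hpp', hpp''⟩ := exists_between hp
    obtain ⟨m, hm, hm'⟩ := exists_forall_gt s p''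
    refine hB.mem_of_ppSet hS (v := ![p, p'', m, p']) ?_
      ⟨s, hs, hp₁, hp₂, fun i _ => hm' i, fun i hi => hpp''.trans (hp₂ i fun h => hi (hIJ h)), hm⟩
    intro x y
    fin_cases x <;> fin_cases y <;> simp <;> constructor <;> intros <;> linarith
  have hS₂ : ∀ a b b' c : ℚ, b < b' → b' < a → a < c → ![a, b, b', c] ∈ S := by
    intro a b b' c hbb hba hac
    obtain ⟨q, q'', hq, hq₁, hq₂⟩ := hJ.exists_threshold
    obtain ⟨q', hqq', hqq''⟩ := exists_between hq
    obtain ⟨m, hm, hm'⟩ := exists_forall_lt t q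
    refine hB.mem_of_ppSet hS (v := ![q', m, q, q'']) ?_
      ⟨t, ht, fun i hi => (hq₁ i (hIJ hi)).trans hqq', fun i _ => hm' i, hq₁, hq₂, hm⟩
    intro x y
    fin_cases x <;> fin_cases y <;> simp <;> constructor <;> intros <;> linarith
  have of_mem : ∀ x ∈ S, x 0 ≤ x 1 → x 2 ≤ x 3 → ∃ u ∈ R, IsCut I u ∧ IsCut J u := by
    rintro x ⟨u, hu, h₀, h₁, h₂, h₃, h₁₂⟩ h₀₁ h₂₃
    exact ⟨u, hu, fun i hi j hj => ((h₀ i hi).trans_le h₀₁).trans (h₁ j hj),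
      fun i hi j hj => ((h₂ i hi).trans_le h₂₃).trans (h₃ j hj)⟩
  -- Two tuples of `S` share coordinate 0. Once both certify `I`, failure of the second certificate
  -- for `J` in the first tuple means `u 3 < u 2`, whence `u 5 < u 3 < u 2 < u 6` certifies `J` in
  -- the second.
  have hP := (hS.reindex ![(0 : Fin 7), 1, 2, 3]).inter
    ((hS.reindex ![(0 : Fin 7), 4, 5, 6]).inter
      ((PPSet.lt hlt (2 : Fin 7) 6).inter (PPSet.lt hlt (5 : Fin 7) 3)))
  have comp : ∀ (x : Fin 7 → ℚ) (p q r w : Fin 7), x ∘ ![p, q, r, w] = ![x p, x q, x r, x w] := by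
    intro x p q r w
    ext i
    fin_cases i <;> rfl
  simp only [Set.mem_ofPred_eq, comp] at hP
  obtain ⟨u, ⟨hu₁, hu₂, h₂₆, h₅₃⟩, h₁, h₄⟩ := hB.exists_le_of_not_rMin hlt hmin hP
    (s := ![2, 4, 5, 3, 0, 1, 6]) (t := ![2, 0, 1, 6, 4, 5, 3])
    ⟨hS₁ 2 4 5 3 (by norm_num) (by norm_num) (by norm_num),
      hS₂ 2 0 1 6 (by norm_num) (by norm_num) (by norm_num), by decide +kernel, by decide +kernel⟩
    ⟨hS₂ 2 0 1 6 (by norm_num) (by norm_num) (by norm_num),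
      hS₁ 2 4 5 3 (by norm_num) (by norm_num) (by norm_num), by decide +kernel, by decide +kernel⟩
    (i := 0) (j := 4) (k := 1) (by decide +kernel) (by decide +kernel) (by decide +kernel)
    (by decide +kernel)
  rcases le_or_gt (u 2) (u 3) with h | h
  · exact of_mem _ hu₁ h₄ h
  · exact of_mem _ hu₂ h₁ (h₅₃.trans (h.trans h₂₆)).le

/-- Helly-type property: finitely many nested cuts attained separately are attained
simultaneously. -/
theorem IsTemporal.exists_forall_isCut (hB : IsTemporal L) (hlt : PPDefinable L ltRel)
    (hmin : ¬ PPDefinable L rMin) [Finite α] {J : ℚ → Set α} (hJ : Monotone J) (F : Finset ℚ)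
    {R : Set (α → ℚ)} (hR : PPSet L R) (hne : R.Nonempty)
    (h : ∀ c ∈ F, ∃ u ∈ R, IsCut (J c) u) : ∃ u ∈ R, ∀ c ∈ F, IsCut (J c) u := by
  induction F using Finset.strongInduction with
  | H F ih =>
    rcases F.eq_empty_or_nonempty with rfl | ⟨c, hc⟩
    · obtain ⟨u, hu⟩ := hne
      exact ⟨u, hu, by simp⟩
    by_cases hF : ∀ d ∈ F, d = c
    · obtain ⟨u, hu, hcut⟩ := h c hc
      exact ⟨u, hu, fun d hd => by rwa [hF d hd]⟩
    push Not at hF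
    obtain ⟨d, hd, hdc⟩ := hF
    -- Drop `c` and `d` in turn. Both tuples satisfy the remaining cuts, a pp-definable condition,
    -- so it suffices to combine the two cuts `c` and `d`.
    obtain ⟨u, hu, hcut⟩ := ih (F.erase c) (Finset.erase_ssubset hc)
      fun e he => h e (Finset.mem_of_mem_erase he)
    obtain ⟨u', hu', hcut'⟩ := ih (F.erase d) (Finset.erase_ssubset hd)
      fun e he => h e (Finset.mem_of_mem_erase he)
    have hR' : PPSet L {t | t ∈ R ∧ ∀ e : ↥((F.erase c).erase d), IsCut (J e) t} :=
      hR.inter (PPSet.forall fun e => PPSet.isCut hlt (J e))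
    have hmem : u ∈ {t | t ∈ R ∧ ∀ e : ↥((F.erase c).erase d), IsCut (J e) t} :=
      ⟨hu, fun e => hcut e (Finset.mem_of_mem_erase e.2)⟩
    have hmem' : u' ∈ {t | t ∈ R ∧ ∀ e : ↥((F.erase c).erase d), IsCut (J e) t} :=
      ⟨hu', fun e => hcut' e (Finset.mem_of_mem_erase (by
        rw [Finset.erase_right_comm]; exact e.2))⟩
    have hd' := hcut d (Finset.mem_erase.2 ⟨hdc, hd⟩)
    have hc' := hcut' c (Finset.mem_erase.2 ⟨hdc.symm, hc⟩)
    obtain ⟨w, ⟨hw, hwF⟩, hwc, hwd⟩ : ∃ w ∈ {t | t ∈ R ∧ ∀ e : ↥((F.erase c).erase d),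
        IsCut (J e) t}, IsCut (J c) w ∧ IsCut (J d) w := by
      rcases le_total c d with hcd | hcd
      · exact hB.exists_isCut_and hlt hmin hR' (hJ hcd) hmem' hmem hc' hd'
      · obtain ⟨w, hw, h₁, h₂⟩ :=
          hB.exists_isCut_and hlt hmin hR' (hJ hcd) hmem hmem' hd' hc'
        exact ⟨w, hw, h₂, h₁⟩
    refine ⟨w, hw, fun e he => ?_⟩
    by_cases hec : e = c
    · rwa [hec]
    by_cases hed : e = d
    · rwa [hed]
    exact hwF ⟨e, by simp [hec, hed, he]⟩

end Cuts

/-! ### The two directions of the dichotomy -/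

section Dichotomy

variable {L : FirstOrder.Language.{u, v}} [L.Structure ℚ] [L.IsRelational]

theorem le_of_preserves_leRel {f : (Fin 2 → ℚ) → ℚ} (hf : Preserves f leRel) {x y : Fin 2 → ℚ}
    (h : x ≤ y) : f x ≤ f y :=
  hf (fun i => ![x i, y i]) fun i => h i

theorem IsTemporal.isPolymorphism_of_not_ppDefinable (hB : IsTemporal L)
    (hlt : PPDefinable L ltRel) (hmin : ¬ PPDefinable L rMin)
    (hmax : ¬ PPDefinable L (dualRel rMin)) {f : (Fin 2 → ℚ) → ℚ} (hinj : Function.Injective f)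
    (hf : Preserves f leRel) : IsPolymorphism L f := by
  intro n R t ht
  set w : Fin n → ℚ := fun j => f fun i => t i j with hw
  -- Cuts force only the strict inequalities of `w`, so its equalities are imposed separately; by
  -- injectivity of `f` both arguments satisfy them.
  have hR : PPSet L {x : Fin n → ℚ | Structure.RelMap R x ∧ ∀ p : Fin n × Fin n,
      w p.1 = w p.2 → x p.1 = x p.2} :=
    (PPSet.relMap R).inter (PPSet.forall fun p => PPSet.imp (w p.1 = w p.2) fun _ =>
      PPSet.eq p.1 p.2)
  have hmem : ∀ i, t i ∈ {x : Fin n → ℚ | Structure.RelMap R x ∧ ∀ p : Fin n × Fin n,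
      w p.1 = w p.2 → x p.1 = x p.2} :=
    fun i => ⟨ht i, fun p hp => congrFun (hinj hp) i⟩
  obtain ⟨u, ⟨hu, hueq⟩, hcut⟩ := hB.exists_forall_isCut hlt hmin
    (J := fun c => {i | w i ≤ c}) (fun c d hcd i hi => le_trans hi hcd)
    (Finset.univ.image w) hR ⟨_, hmem 0⟩ fun c _ =>
      hB.exists_isCut_of_lower hlt hmin hmax hR (hmem 0) (hmem 1) fun i j h₀ h₁ hj =>
        le_trans (le_of_preserves_leRel hf (Fin.forall_fin_two.2 ⟨h₀, h₁⟩)) hj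
  have hlt_of : ∀ i j, w i < w j → u i < u j := fun i j hij =>
    hcut (w i) (Finset.mem_image_of_mem w (Finset.mem_univ i)) i (le_refl (w i)) j (not_le.2 hij)
  refine hB.mem_of_ppSet (PPSet.relMap R) (v := u) (fun i j => ⟨fun h => ?_, hlt_of i j⟩) hu
  by_contra hn
  rcases (not_lt.1 hn).lt_or_eq with h' | h'
  · exact lt_asymm h (hlt_of j i h')
  · exact h.ne (hueq (i, j) h'.symm)

/-- An injective monotone operation placing the ideal `{x | x 0 ≤ 1 ∧ x 1 ≤ 1}` below its
complement. -/
theorem exists_injective_monotone : ∃ f : (Fin 2 → ℚ) → ℚ, Function.Injective f ∧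
    Preserves f leRel ∧ f ![1, 1] < f ![0, 2] ∧ f ![1, 1] < f ![2, 0] := by
  classical
  have : Countable (ℕ ×ₗ ℚ ×ₗ ℚ) := inferInstanceAs (Countable (ℕ × ℚ × ℚ))
  obtain ⟨e⟩ := Order.embedding_from_countable_to_dense (α := ℕ ×ₗ ℚ ×ₗ ℚ) (β := ℚ)
  -- The leading lexicographic entry separates the ideal from its complement; the remaining entries
  -- give injectivity.
  let r : (Fin 2 → ℚ) → ℕ := fun x => if x 0 ≤ 1 ∧ x 1 ≤ 1 then 0 else 1
  refine ⟨fun x => e (toLex (r x, toLex (x 0, x 1))), ?_, ?_, ?_, ?_⟩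
  · intro x y hxy
    have := e.injective hxy
    simp only [EmbeddingLike.apply_eq_iff_eq, Prod.mk.injEq] at this
    ext i
    fin_cases i
    exacts [this.2.1, this.2.2]
  · intro t ht
    have h₀ : t 0 0 ≤ t 0 1 := ht 0
    have h₁ : t 1 0 ≤ t 1 1 := ht 1
    refine e.monotone (Prod.Lex.toLex_mono ⟨?_, Prod.Lex.toLex_mono ⟨h₀, h₁⟩⟩)
    by_cases h : t 0 1 ≤ 1 ∧ t 1 1 ≤ 1
    · simp [r, h, h₀.trans h.1, h₁.trans h.2]
    · simp only [r, h, if_false]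
      split_ifs <;> simp
  all_goals
    refine e.strictMono (Prod.Lex.toLex_lt_toLex.2 (Or.inl ?_))
    simp [r]

theorem exists_not_isPolymorphism_of_rMin (h : PPDefinable L rMin) :
    ∃ f : (Fin 2 → ℚ) → ℚ, Function.Injective f ∧ Preserves f leRel ∧ ¬ IsPolymorphism L f := by
  obtain ⟨f, hinj, hf, h₁, h₂⟩ := exists_injective_monotone
  refine ⟨f, hinj, hf, fun hpol => ?_⟩
  have hc : ∀ (t : Fin 2 → Fin 3 → ℚ) (a : Fin 3), (fun i => t i a) = ![t 0 a, t 1 a] :=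
    fun t a => by ext i; fin_cases i <;> rfl
  have := h.ppSet.preserves hpol ![![1, 0, 2], ![1, 2, 0] ]
    (by intro i; fin_cases i <;> simp [rMin]) 0
  simp only [rMin, Set.mem_ofPred_eq, hc] at this
  exact this.elim (lt_asymm h₁) (lt_asymm h₂)

theorem exists_not_isPolymorphism_of_dualRel_rMin (h : PPDefinable L (dualRel rMin)) :
    ∃ f : (Fin 2 → ℚ) → ℚ, Function.Injective f ∧ Preserves f leRel ∧ ¬ IsPolymorphism L f := by
  obtain ⟨f, hinj, hf, h₁, h₂⟩ := exists_injective_monotone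
  refine ⟨fun x => -f (-x), fun x y hxy => neg_injective (hinj (neg_injective hxy)), ?_,
    fun hpol => ?_⟩
  · intro t ht
    exact neg_le_neg (le_of_preserves_leRel hf fun i => neg_le_neg (ht i))
  have hc : ∀ x : Fin 2 → ℚ, -x = ![-x 0, -x 1] := fun x => by ext i; fin_cases i <;> rfl
  have := h.ppSet.preserves hpol ![![-1, 0, -2], ![-1, -2, 0] ]
    (by intro i; fin_cases i <;> simp [dualRel_rMin]) 0
  rw [dualRel_rMin] at this
  simp only [Set.mem_ofPred_eq, hc, neg_lt_neg_iff] at this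
  norm_num at this
  exact this.elim (lt_asymm h₁) (lt_asymm h₂)

end Dichotomy

end TemporalCSP

theorem mainTheorem10 (L : FirstOrder.Language.{u, v}) [L.IsRelational]
    [L.Structure ℚ] (hB : TemporalCSP.IsTemporal L)
    (hlt : TemporalCSP.PPDefinable L TemporalCSP.ltRel) :
    Xor
      (TemporalCSP.PPDefinable L TemporalCSP.rMin ∨
        TemporalCSP.PPDefinable L (TemporalCSP.dualRel TemporalCSP.rMin))
      (∀ f : (Fin 2 → ℚ) → ℚ, Function.Injective f →
        TemporalCSP.Preserves f TemporalCSP.leRel → TemporalCSP.IsPolymorphism L f) := by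
  by_cases h : TemporalCSP.PPDefinable L TemporalCSP.rMin ∨
      TemporalCSP.PPDefinable L (TemporalCSP.dualRel TemporalCSP.rMin)
  · refine Or.inl ⟨h, fun hall => ?_⟩
    obtain ⟨f, hinj, hf, hpol⟩ := h.elim TemporalCSP.exists_not_isPolymorphism_of_rMin
      TemporalCSP.exists_not_isPolymorphism_of_dualRel_rMin
    exact hpol (hall f hinj hf)
  · rw [not_or] at h
    exact Or.inr ⟨fun f hinj hf => hB.isPolymorphism_of_not_ppDefinable hlt h.1 h.2 hinj hf,
      not_or.2 h⟩
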